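/- Let $X$ be a nondegenerate Peano continuum, i.e. a compact, connected, locally connected, metrizable space with at least two points. Then there is a point $x\in X$ such that at least one of the following holds: 1. $x$ is not a local cut point of $X$; or 2. $x$ is a local cut point of $X$, $x$ is not a cut point of $X$, and the Menger order of $x$ in $X$ is equal to $2$. Here $x$ is a *cut point* of $X$ if $X\setminus\{x\}$ is not connected; $x$ is a *local cut point* of $X$ if there is a connected neighborhood $V$ of $x$ in $X$ such that $V\setminus\{x\}$ is not connected; and the *Menger order* of $x$ in $X$ is the least natural number $n$ such that $x$ has a basis of neighborhoods formed by sets whose boundaries in $X$ have at most $n$ points, if such an $n$ exists, and $\infty$ otherwise. -/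

import Mathlib

open scoped Topology

namespace PeanoContinuum

variable {X : Type*} [TopologicalSpace X]

/-- `x` is a cut point of the (connected) space `X`: removing it disconnects `X`. -/
def IsCutPoint (x : X) : Prop :=
  ¬ IsPreconnected ({x}ᶜ : Set X)

/-- `x` is a local cut point of `X`: some connected neighbourhood `V` of `x` (not necessarily
open) is disconnected by removing `x`. -/
def IsLocalCutPoint (x : X) : Prop :=
  ∃ V ∈ 𝓝 x, IsConnected V ∧ ¬ IsPreconnected (V \ {x})

/-- The neighbourhood system of `x` has a basis `B` formed by sets whose boundaries
have at most `n` points. -/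
def HasSmallBoundaryBasis (x : X) (n : ℕ) : Prop :=
  ∃ B : Set (Set X), (𝓝 x).HasBasis (fun V : Set X => V ∈ B) id ∧
    ∀ V ∈ B, (frontier V).encard ≤ (n : ℕ∞)

/-- The Menger order of `x` in `X`: the least natural number `n` such that `x` has a
neighbourhood basis formed by sets with at most `n` boundary points, and `⊤` if there is no
such natural number (the infimum of the empty set in `ℕ∞` is `⊤`). -/
noncomputable def mengerOrder (x : X) : ℕ∞ :=
  sInf {k : ℕ∞ | ∃ n : ℕ, k = (n : ℕ∞) ∧ HasSmallBoundaryBasis x n}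

end PeanoContinuum

/-! Suppose every point is a local cut point and no non-cut point has Menger order 2. A local cut
point always has order at least 2 (`IsLocalCutPoint.two_le`), and only countably many have order
above 2 (`countable_isLocalCutPoint_not_hasSmallBoundaryBasis_two`). So the set N of non-cut points
is countable. N is nonempty and a Gδ, hence a Baire space, so by countability it has an isolated
point. Near such a point p all other points are cut points, which forces order at most 1 at p
(`hasSmallBoundaryBasis_one_of_isolated`): a contradiction. -/

open Set Filter TopologicalSpace

namespace PeanoContinuum

/-! ### Components left after deleting a point, and the order of separating points -/

section Components

variable {X : Type*} [TopologicalSpace X]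

/-- `x` separates `a` and `b` in `U`: they lie in different components of `U \ {x}`. -/
def Separates (U : Set X) (x a b : X) : Prop :=
  a ∈ U \ {x} ∧ b ∈ U \ {x} ∧ b ∉ connectedComponentIn (U \ {x}) a

lemma disjoint_connectedComponentIn {G : Set X} {a b : X} (h : b ∉ connectedComponentIn G a) :
    Disjoint (connectedComponentIn G a) (connectedComponentIn G b) := by
  rw [Set.disjoint_left]
  intro z hza hzb
  have hb : b ∈ G := connectedComponentIn_nonempty_iff.1 ⟨z, hzb⟩
  apply h
  rw [connectedComponentIn_eq hza, ← connectedComponentIn_eq hzb]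
  exact mem_connectedComponentIn hb

lemma Separates.symm {U : Set X} {x a b : X} (h : Separates U x a b) : Separates U x b a := by
  refine ⟨h.2.1, h.1, fun hab => h.2.2 ?_⟩
  rw [← connectedComponentIn_eq hab]
  exact mem_connectedComponentIn h.2.1

lemma exists_notMem_connectedComponentIn {G : Set X} (h : ¬ IsPreconnected G) :
    ∃ a ∈ G, ∃ b ∈ G, b ∉ connectedComponentIn G a := by
  by_contra! H
  refine h (isPreconnected_of_forall_pair fun a ha b hb => ?_)
  exact ⟨_, connectedComponentIn_subset _ _, mem_connectedComponentIn ha, H a ha b hb,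
    isPreconnected_connectedComponentIn⟩

lemma isPreconnected_iff_not_separates {U : Set X} {x : X} :
    IsPreconnected (U \ {x}) ↔ ∀ a b, ¬ Separates U x a b := by
  constructor
  · rintro h a b ⟨ha, hb, hab⟩
    exact hab (h.subset_connectedComponentIn ha subset_rfl hb)
  · intro h
    by_contra H
    obtain ⟨a, ha, b, hb, hab⟩ := exists_notMem_connectedComponentIn H
    exact h a b ⟨ha, hb, hab⟩

lemma Separates.mem {U : Set X} (hU' : IsPreconnected U) {x a b : X} (h : Separates U x a b) :
    x ∈ U := by
  by_contra hx
  refine isPreconnected_iff_not_separates.1 ?_ a b h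
  rwa [sdiff_singleton_eq_self hx]

variable [LocallyConnectedSpace X]

lemma closure_connectedComponentIn_inter_subset {G : Set X} (hG : IsOpen G) (a : X) :
    closure (connectedComponentIn G a) ∩ G ⊆ connectedComponentIn G a := by
  rintro z ⟨hz, hzG⟩
  obtain ⟨y, hyz, hya⟩ := mem_closure_iff.1 hz _ (hG.connectedComponentIn (x := z))
    (mem_connectedComponentIn hzG)
  rw [connectedComponentIn_eq hya, ← connectedComponentIn_eq hyz]
  exact mem_connectedComponentIn hzG

lemma frontier_connectedComponentIn_subset {G : Set X} (hG : IsOpen G) (a : X) :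
    frontier (connectedComponentIn G a) ⊆ Gᶜ := by
  intro z hz hzG
  rw [hG.connectedComponentIn.frontier_eq] at hz
  exact hz.2 (closure_connectedComponentIn_inter_subset hG a ⟨hz.1, hzG⟩)

/-- A compact subset of an open connected set is contained in a connected open set whose closure
is still inside. -/
lemma exists_isOpen_isPreconnected_closure_subset [RegularSpace X] {C F : Set X} (hC : IsOpen C)
    (hC' : IsPreconnected C) (hF : IsCompact F) (hFC : F ⊆ C) :
    ∃ K, IsOpen K ∧ IsPreconnected K ∧ F ⊆ K ∧ closure K ⊆ C := by
  rcases C.eq_empty_or_nonempty with rfl | ⟨a, ha⟩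
  · exact ⟨∅, isOpen_empty, isPreconnected_empty, hFC, by simp⟩
  have small : ∀ z ∈ C, ∃ G, IsOpen G ∧ IsPreconnected G ∧ z ∈ G ∧ closure G ⊆ C := by
    intro z hz
    obtain ⟨V, hV, hVc, hVC⟩ := exists_mem_nhds_isClosed_subset (hC.mem_nhds hz)
    refine ⟨connectedComponentIn (interior V) z, isOpen_interior.connectedComponentIn,
      isPreconnected_connectedComponentIn,
      mem_connectedComponentIn (mem_interior_iff_mem_nhds.2 hV), ?_⟩
    exact (closure_minimal ((connectedComponentIn_subset _ _).trans interior_subset) hVc).trans hVC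
  let 𝒦 : Set (Set X) := {K | IsOpen K ∧ IsPreconnected K ∧ a ∈ K ∧ closure K ⊆ C}
  have hne : Nonempty 𝒦 := by
    obtain ⟨G, h1, h2, h3, h4⟩ := small a ha
    exact ⟨⟨G, h1, h2, h3, h4⟩⟩
  -- The union of `𝒦` is open and relatively closed in the connected set `C`. All members share `a`,
  -- so the family is directed.
  have hcover : C ⊆ ⋃ K : 𝒦, (K : Set X) := by
    refine hC'.subset_of_closure_inter_subset (isOpen_iUnion fun K => K.2.1) ?_ ?_
    · obtain ⟨K⟩ := hne
      exact ⟨a, ha, mem_iUnion.2 ⟨K, K.2.2.2.1⟩⟩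
    · rintro z ⟨hz, hzC⟩
      obtain ⟨G, h1, h2, h3, h4⟩ := small z hzC
      obtain ⟨y, hyG, hy⟩ := mem_closure_iff.1 hz G h1 h3
      obtain ⟨K, hyK⟩ := mem_iUnion.1 hy
      refine mem_iUnion.2 ⟨⟨K ∪ G, K.2.1.union h1, ?_, Or.inl K.2.2.2.1, ?_⟩, Or.inr h3⟩
      · exact K.2.2.1.union y hyK hyG h2
      · rw [closure_union]
        exact union_subset K.2.2.2.2 h4
  obtain ⟨K, hK⟩ := hF.elim_directed_cover (fun K : 𝒦 => (K : Set X)) (fun K => K.2.1)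
    (hFC.trans hcover) (fun K L => ⟨⟨K ∪ L, K.2.1.union L.2.1,
      K.2.2.1.union a K.2.2.2.1 L.2.2.2.1 L.2.2.1, Or.inl K.2.2.2.1, by
        rw [closure_union]; exact union_subset K.2.2.2.2 L.2.2.2.2⟩,
      subset_union_left, subset_union_right⟩)
  exact ⟨K, K.2.1, K.2.2.1, hK, K.2.2.2.2⟩

variable [T1Space X]

lemma isOpen_component {U : Set X} (hU : IsOpen U) (x a : X) :
    IsOpen (connectedComponentIn (U \ {x}) a) :=
  (hU.sdiff isClosed_singleton).connectedComponentIn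

/-- Otherwise the component would be clopen in the connected set `U`. -/
lemma mem_closure_component {U : Set X} (hU : IsOpen U) (hU' : IsPreconnected U) {x a : X}
    (hx : x ∈ U) (ha : a ∈ U \ {x}) : x ∈ closure (connectedComponentIn (U \ {x}) a) := by
  by_contra h
  have hsub : U ⊆ connectedComponentIn (U \ {x}) a := by
    refine hU'.subset_of_closure_inter_subset (isOpen_component hU x a)
      ⟨a, ha.1, mem_connectedComponentIn ha⟩ ?_
    rintro z ⟨hz, hzU⟩
    refine closure_connectedComponentIn_inter_subset (hU.sdiff isClosed_singleton) a ⟨hz, hzU, ?_⟩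
    rintro rfl
    exact h hz
  exact (connectedComponentIn_subset _ _ (hsub hx)).2 rfl

lemma isPreconnected_insert_component {U : Set X} (hU : IsOpen U) (hU' : IsPreconnected U)
    {x a : X} (hx : x ∈ U) (ha : a ∈ U \ {x}) :
    IsPreconnected (insert x (connectedComponentIn (U \ {x}) a)) :=
  isPreconnected_connectedComponentIn.subset_closure (subset_insert _ _)
    (insert_subset (mem_closure_component hU hU' hx ha) subset_closure)

/-- If `y` is not in the component of `a` in `U \ {x}`, then that component and `x` lie in the
component of `a` in `U \ {y}`. -/
lemma insert_component_subset {U : Set X} (hU : IsOpen U) (hU' : IsPreconnected U) {x y a : X}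
    (hx : x ∈ U) (hyx : y ≠ x) (ha : a ∈ U \ {x})
    (hy : y ∉ connectedComponentIn (U \ {x}) a) :
    insert x (connectedComponentIn (U \ {x}) a) ⊆ connectedComponentIn (U \ {y}) a := by
  refine (isPreconnected_insert_component hU hU' hx ha).subset_connectedComponentIn
    (mem_insert_of_mem _ (mem_connectedComponentIn ha)) ?_
  rintro z (rfl | hz)
  · exact ⟨hx, hyx.symm⟩
  · refine ⟨(connectedComponentIn_subset _ _ hz).1, ?_⟩
    rintro rfl
    exact hy hz

/-- If `y` is in the component of `a` in `U \ {x}` and both points separate `a` and `b`, then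
`x` is not in the component of `a` in `U \ {y}`. -/
lemma notMem_component_of_mem {U : Set X} (hU : IsOpen U) (hU' : IsPreconnected U) {x y a b : X}
    (hx : Separates U x a b) (hy : Separates U y a b)
    (hyx : y ∈ connectedComponentIn (U \ {x}) a) : x ∉ connectedComponentIn (U \ {y}) a := by
  intro hxy
  have hne : y ≠ x := fun h => (connectedComponentIn_subset _ _ hyx).2 h
  have hyb : y ∉ connectedComponentIn (U \ {x}) b :=
    Set.disjoint_left.1 (disjoint_connectedComponentIn hx.2.2) hyx
  have h1 := insert_component_subset hU hU' (hx.mem hU') hne hx.2.1 hyb (mem_insert _ _)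
  exact Set.disjoint_left.1 (disjoint_connectedComponentIn hy.2.2) hxy h1

/-- At most one point separates three points pairwise. -/
lemma subsingleton_separates_three {U : Set X} (hU : IsOpen U) (hU' : IsPreconnected U)
    (a b c : X) :
    {x | Separates U x a b ∧ Separates U x a c ∧ Separates U x b c}.Subsingleton := by
  rintro x ⟨hab, hac, hbc⟩ y ⟨kab, kac, kbc⟩
  by_contra hne
  -- If `y` were on neither side, both sides would stay joined through `x` in `U \ {y}`. Applied to
  -- all three pairs, this puts `y` in two of three disjoint components.
  have key : ∀ {p q : X}, Separates U x p q → Separates U y p q →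
      y ∈ connectedComponentIn (U \ {x}) p ∨ y ∈ connectedComponentIn (U \ {x}) q := by
    intro p q hx hy
    by_contra! h
    have h1 := insert_component_subset hU hU' (hx.mem hU') (Ne.symm hne) hx.1 h.1 (mem_insert _ _)
    have h2 := insert_component_subset hU hU' (hx.mem hU') (Ne.symm hne) hx.2.1 h.2
      (mem_insert _ _)
    exact Set.disjoint_left.1 (disjoint_connectedComponentIn hy.2.2) h1 h2
  have dab : y ∈ connectedComponentIn (U \ {x}) a → y ∉ connectedComponentIn (U \ {x}) b :=
    fun h => Set.disjoint_left.1 (disjoint_connectedComponentIn hab.2.2) h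
  have dac : y ∈ connectedComponentIn (U \ {x}) a → y ∉ connectedComponentIn (U \ {x}) c :=
    fun h => Set.disjoint_left.1 (disjoint_connectedComponentIn hac.2.2) h
  have dbc : y ∈ connectedComponentIn (U \ {x}) b → y ∉ connectedComponentIn (U \ {x}) c :=
    fun h => Set.disjoint_left.1 (disjoint_connectedComponentIn hbc.2.2) h
  have k1 := key hab kab
  have k2 := key hac kac
  have k3 := key hbc kbc
  tauto

/-- Among the points of `B` separating `a` and `b`, at most one is not preceded by another one. -/
lemma subsingleton_separates_first {U : Set X} (hU : IsOpen U) (hU' : IsPreconnected U)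
    (a b : X) (B : Set X) :
    {x | x ∈ B ∧ Separates U x a b ∧
      ∀ y ∈ B, Separates U y a b → y ∉ connectedComponentIn (U \ {x}) a}.Subsingleton := by
  rintro x ⟨hxB, hx, hx'⟩ y ⟨hyB, hy, hy'⟩
  by_contra hne
  exact hy' x hxB hx (insert_component_subset hU hU' (hx.mem hU') (Ne.symm hne) hx.1
    (hx' y hyB hy) (mem_insert _ _))

end Components

/-! ### Menger order of a local cut point is at least two -/

section Order

variable {X : Type*} [TopologicalSpace X]

lemma hasSmallBoundaryBasis_of_forall {x : X} {n : ℕ}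
    (h : ∀ O : Set X, IsOpen O → x ∈ O → ∃ V ∈ 𝓝 x, V ⊆ O ∧ (frontier V).encard ≤ (n : ℕ∞)) :
    HasSmallBoundaryBasis x n := by
  refine ⟨{V | V ∈ 𝓝 x ∧ (frontier V).encard ≤ (n : ℕ∞)}, ⟨fun t => ?_⟩, fun V hV => hV.2⟩
  constructor
  · intro ht
    obtain ⟨V, hV, hVO, hVn⟩ := h (interior t) isOpen_interior (mem_interior_iff_mem_nhds.2 ht)
    exact ⟨V, ⟨hV, hVn⟩, hVO.trans interior_subset⟩
  · rintro ⟨V, hV, hVt⟩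
    exact Filter.mem_of_superset hV.1 hVt

variable [T1Space X]

/-- If `W \ {x}` were connected, it would lie on one side of a separation of `V \ {x}`; adding `W`
to that side would separate `V` itself. -/
lemma IsLocalCutPoint.exists_open {x : X} (h : IsLocalCutPoint x) :
    ∃ V ∈ 𝓝 x, ∀ W ⊆ V, IsOpen W → x ∈ W → ¬ IsPreconnected (W \ {x}) := by
  obtain ⟨V, hV, hVc, hVx⟩ := h
  refine ⟨V, hV, fun W hWV hWo hxW hW => hVx ?_⟩
  have key : ∀ u v : Set X, IsOpen u → IsOpen v → V \ {x} ⊆ u ∪ v →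
      ((V \ {x}) ∩ u).Nonempty → ((V \ {x}) ∩ v).Nonempty → W \ {x} ⊆ u →
      ((V \ {x}) ∩ (u ∩ v)).Nonempty := by
    rintro u v hu hv huv ⟨p, hp, hpu⟩ ⟨q, hq, hqv⟩ hWu
    obtain ⟨z, hzV, hz1, hz2⟩ := hVc.isPreconnected (u ∪ W) (v \ {x}) (hu.union hWo)
      (hv.sdiff isClosed_singleton) (by
        intro z hz
        by_cases hzx : z = x
        · exact Or.inl (Or.inr (hzx ▸ hxW))
        · rcases huv ⟨hz, hzx⟩ with h | h
          · exact Or.inl (Or.inl h)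
          · exact Or.inr ⟨h, hzx⟩) ⟨p, hp.1, Or.inl hpu⟩ ⟨q, hq.1, hqv, hq.2⟩
    refine ⟨z, ⟨hzV, hz2.2⟩, ?_, hz2.1⟩
    rcases hz1 with h | h
    · exact h
    · exact hWu ⟨h, hz2.2⟩
  intro u v hu hv huv hpu hpv
  by_contra hemp
  have hsub : W \ {x} ⊆ V \ {x} := sdiff_subset_sdiff_left hWV
  rcases (isPreconnected_iff_subset_of_disjoint.1 hW) u v hu hv (hsub.trans huv) (by
    rw [← Set.not_nonempty_iff_eq_empty]
    rintro ⟨z, hz, hz'⟩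
    exact hemp ⟨z, hsub hz, hz'⟩) with h | h
  · exact hemp (key u v hu hv huv hpu hpv h)
  · rw [Set.inter_comm u v] at hemp
    exact hemp (key v u hv hu (by rwa [Set.union_comm]) hpv hpu h)

variable [LocallyConnectedSpace X]

/-- A set of small boundary around a local cut point needs two boundary points. -/
lemma IsLocalCutPoint.two_le {x : X} (h : IsLocalCutPoint x) {n : ℕ}
    (hn : HasSmallBoundaryBasis x n) : 2 ≤ n := by
  obtain ⟨V, hV, hVW⟩ := h.exists_open
  set U := connectedComponentIn (interior V) x
  have hU : IsOpen U := isOpen_interior.connectedComponentIn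
  have hU' : IsPreconnected U := isPreconnected_connectedComponentIn
  have hxU : x ∈ U := mem_connectedComponentIn (mem_interior_iff_mem_nhds.2 hV)
  have hUV : U ⊆ V := (connectedComponentIn_subset _ _).trans interior_subset
  obtain ⟨a, ha, b, hb, hab⟩ := exists_notMem_connectedComponentIn (hVW U hUV hU hxU)
  obtain ⟨B, hB, hBn⟩ := hn
  obtain ⟨W, hWB, hW⟩ := hB.mem_iff.1 (Filter.inter_mem (isOpen_ne.mem_nhds (Ne.symm ha.2))
    (isOpen_ne.mem_nhds (Ne.symm hb.2)))
  have hxW : x ∈ interior W := mem_interior_iff_mem_nhds.2 (hB.mem_of_mem hWB)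
  -- A component together with `x` is connected, so it crosses the boundary on its way out of `W`;
  -- distinct components give distinct boundary points.
  have key : ∀ c ∈ U \ {x}, c ∉ W → ∃ p ∈ connectedComponentIn (U \ {x}) c, p ∈ frontier W := by
    intro c hc hcW
    by_contra! hno
    have hsub := (isPreconnected_insert_component hU hU' hxU hc).subset_of_closure_inter_subset
      (isOpen_interior (s := W)) ⟨x, mem_insert _ _, hxW⟩ (by
        rintro z ⟨hz, rfl | hz'⟩
        · exact hxW
        · by_contra hzi
          exact hno z hz' ⟨closure_mono interior_subset hz, hzi⟩)
    exact hcW (interior_subset (hsub (mem_insert_of_mem _ (mem_connectedComponentIn hc))))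
  obtain ⟨p, hp, hpW⟩ := key a ha (fun h => (hW h).1 rfl)
  obtain ⟨q, hq, hqW⟩ := key b hb (fun h => (hW h).2 rfl)
  have hpq : p ≠ q := by
    rintro rfl
    exact Set.disjoint_left.1 (disjoint_connectedComponentIn hab) hp hq
  have h2 : (2 : ℕ∞) ≤ (frontier W).encard := by
    rw [← Set.encard_pair hpq]
    exact Set.encard_le_encard (by rintro z (rfl | rfl) <;> assumption)
  exact_mod_cast h2.trans (hBn W hWB)

lemma IsLocalCutPoint.mengerOrder_eq_two {x : X} (h : IsLocalCutPoint x)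
    (h2 : HasSmallBoundaryBasis x 2) : mengerOrder x = 2 := by
  refine le_antisymm (sInf_le ⟨2, rfl, h2⟩) (le_sInf ?_)
  rintro _ ⟨n, rfl, hn⟩
  exact_mod_cast h.two_le hn

end Order

/-! ### Countably many local cut points of order above two -/

section LocalStructure

variable {X : Type*} [TopologicalSpace X] [LocallyConnectedSpace X]

-- Components of a basic open set are open, so each is the component of some point of a countable
-- dense set.
variable (X) in
lemma exists_countable_isOpen_isPreconnected [SecondCountableTopology X] :
    ∃ 𝒰 : Set (Set X), 𝒰.Countable ∧ (∀ U ∈ 𝒰, IsOpen U ∧ IsPreconnected U) ∧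
      ∀ (x : X) (V : Set X), V ∈ 𝓝 x → ∃ U ∈ 𝒰, x ∈ U ∧ U ⊆ V := by
  obtain ⟨D, hDc, hD⟩ := exists_countable_dense X
  refine ⟨image2 connectedComponentIn (countableBasis X) D,
    (countable_countableBasis X).image2 hDc _, ?_, ?_⟩
  · rintro _ ⟨B, hB, d, -, rfl⟩
    exact ⟨((isBasis_countableBasis X).isOpen hB).connectedComponentIn,
      isPreconnected_connectedComponentIn⟩
  · intro x V hV
    obtain ⟨B, hB, hxB, hBV⟩ := (isBasis_countableBasis X).mem_nhds_iff.1 hV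
    have hBo := (isBasis_countableBasis X).isOpen hB
    obtain ⟨d, hd, hdD⟩ := hD.inter_open_nonempty _ (hBo.connectedComponentIn (x := x))
      ⟨x, mem_connectedComponentIn hxB⟩
    refine ⟨_, ⟨B, hB, d, hdD, rfl⟩, ?_, (connectedComponentIn_subset _ _).trans hBV⟩
    rw [← connectedComponentIn_eq hd]
    exact mem_connectedComponentIn hxB

variable [T1Space X]

/-- `x` is, from the side of `a`, a limit of points separating `a` and `b`. -/
def IsSideLimit (U : Set X) (x a b : X) : Prop :=
  x ∈ closure {y | Separates U y a b ∧ y ∈ connectedComponentIn (U \ {x}) a}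

/-- If `x` is a limit of separating points from the side of `a`, then any compact part of that
side can be cut off from `x` by a point close to `x`. -/
lemma IsSideLimit.exists_separates [RegularSpace X] {U : Set X} (hU : IsOpen U) {x a b : X}
    (h : IsSideLimit U x a b) (hx : Separates U x a b)
    {F : Set X} (hF : IsCompact F) (hFa : F ⊆ connectedComponentIn (U \ {x}) a) {O : Set X}
    (hO : IsOpen O) (hxO : x ∈ O) :
    ∃ y ∈ O, Separates U y a b ∧ y ∈ connectedComponentIn (U \ {x}) a ∧
      F ⊆ connectedComponentIn (U \ {y}) a := by
  have haC := mem_connectedComponentIn hx.1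
  obtain ⟨K, hKo, hKc, hFK, hK⟩ := exists_isOpen_isPreconnected_closure_subset
    (isOpen_component hU x a) isPreconnected_connectedComponentIn (hF.insert a)
    (insert_subset haC hFa)
  have hxK : x ∉ closure K := fun h => (connectedComponentIn_subset _ _ (hK h)).2 rfl
  obtain ⟨y, ⟨hyO, hyK⟩, hy, hyx⟩ := mem_closure_iff.1 h (O ∩ (closure K)ᶜ)
    (hO.inter isClosed_closure.isOpen_compl) ⟨hxO, hxK⟩
  refine ⟨y, hyO, hy, hyx, (subset_insert _ _).trans (hFK.trans ?_)⟩
  refine hKc.subset_connectedComponentIn (hFK (mem_insert _ _)) fun z hz => ⟨?_, ?_⟩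
  · exact (connectedComponentIn_subset _ _ (hK (subset_closure hz))).1
  · rintro rfl
    exact hyK (subset_closure hz)

/-- A point with exactly two local sides, both of which it is a limit of separating points from,
has Menger order at most two. -/
lemma hasSmallBoundaryBasis_two [RegularSpace X] [LocallyCompactSpace X] {U : Set X}
    (hU : IsOpen U) (hU' : IsPreconnected U) {x a b : X} (hx : Separates U x a b)
    (hcover : U \ {x} ⊆ connectedComponentIn (U \ {x}) a ∪ connectedComponentIn (U \ {x}) b)
    (ha : IsSideLimit U x a b) (hb : IsSideLimit U x b a) : HasSmallBoundaryBasis x 2 := by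
  have hxU : x ∈ U := hx.mem hU'
  refine hasSmallBoundaryBasis_of_forall fun O' hO' hxO' => ?_
  obtain ⟨L, hL, hLU, hLc⟩ := local_compact_nhds ((hO'.inter hU).mem_nhds ⟨hxO', hxU⟩)
  obtain ⟨M, hM, hMc, hML⟩ := exists_mem_nhds_isClosed_subset hL
  set O := interior M
  have hO : IsOpen O := isOpen_interior
  have hxO : x ∈ O := mem_interior_iff_mem_nhds.2 hM
  have hclM : closure O ⊆ M := closure_minimal interior_subset hMc
  have hfr : IsCompact (frontier O) :=
    hLc.of_isClosed_subset isClosed_frontier (frontier_subset_closure.trans (hclM.trans hML))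
  have hfrU : frontier O ⊆ U \ {x} := by
    intro z hz
    refine ⟨(hLU (hML (hclM hz.1))).2, ?_⟩
    rintro rfl
    exact hz.2 (by rwa [hO.interior_eq])
  have side : ∀ {c d : X}, Separates U x c d → IsSideLimit U x c d →
      U \ {x} ⊆ connectedComponentIn (U \ {x}) c ∪ connectedComponentIn (U \ {x}) d →
      -- A single point `y` cuts `x` off from the part of `frontier O` on the side of `c`. That part
      -- is compact because the other side is open and the two sides cover.
      ∃ y ∈ U \ {x}, ∀ I : Set X, IsPreconnected I → x ∈ I → I ⊆ U \ {y} →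
        Disjoint I (frontier O ∩ connectedComponentIn (U \ {x}) c) := by
    intro c d hcd hlim hcov
    have hcomp : IsCompact (frontier O ∩ connectedComponentIn (U \ {x}) c) := by
      have : frontier O ∩ connectedComponentIn (U \ {x}) c
          = frontier O \ connectedComponentIn (U \ {x}) d := by
        ext z
        constructor
        · exact fun hz =>
            ⟨hz.1, Set.disjoint_left.1 (disjoint_connectedComponentIn hcd.2.2) hz.2⟩
        · exact fun hz => ⟨hz.1, (hcov (hfrU hz.1)).resolve_right hz.2⟩
      rw [this]
      exact hfr.diff (isOpen_component hU x d)
    obtain ⟨y, -, hy, hyx, hF⟩ := hlim.exists_separates hU hcd hcomp inter_subset_right hO hxO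
    refine ⟨y, connectedComponentIn_subset _ _ hyx, fun I hI hxI hIU => ?_⟩
    have hxy := notMem_component_of_mem hU hU' hcd hy hyx
    refine (disjoint_connectedComponentIn hxy).symm.mono
      (hI.subset_connectedComponentIn hxI hIU) hF
  obtain ⟨y, hyU, hy⟩ := side hx ha hcover
  obtain ⟨y', hyU', hy'⟩ := side hx.symm hb (by rwa [union_comm])
  have hG : IsOpen (U \ {y, y'}) := hU.sdiff (Set.toFinite _).isClosed
  have hxG : x ∈ U \ {y, y'} := by
    refine ⟨hxU, ?_⟩
    rintro (h | h)
    · exact hyU.2 h.symm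
    · exact hyU'.2 h.symm
  -- Cut off on both sides, `I` cannot reach `frontier O`, so it stays in `O` and its boundary lies
  -- in `{y, y'}`.
  set I := connectedComponentIn (U \ {y, y'}) x
  have hIo : IsOpen I := hG.connectedComponentIn
  have hIc : IsPreconnected I := isPreconnected_connectedComponentIn
  have hxI : x ∈ I := mem_connectedComponentIn hxG
  have hIG : I ⊆ U \ {y, y'} := connectedComponentIn_subset _ _
  have h1 := hy I hIc hxI fun z hz => ⟨(hIG hz).1, fun h => (hIG hz).2 (Or.inl h)⟩
  have h2 := hy' I hIc hxI fun z hz => ⟨(hIG hz).1, fun h => (hIG hz).2 (Or.inr h)⟩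
  have hsubO : I ⊆ O := by
    refine hIc.subset_of_closure_inter_subset hO ⟨x, hxI, hxO⟩ ?_
    rintro z ⟨hz, hzI⟩
    by_contra hzO
    have hzf : z ∈ frontier O := ⟨hz, by rwa [hO.interior_eq]⟩
    rcases hcover (hfrU hzf) with h | h
    · exact Set.disjoint_left.1 h1 hzI ⟨hzf, h⟩
    · exact Set.disjoint_left.1 h2 hzI ⟨hzf, h⟩
  refine ⟨I, hIo.mem_nhds hxI, fun z hz => (hLU (hML (interior_subset (hsubO hz)))).1, ?_⟩
  have hsub : frontier I ⊆ {y, y'} := by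
    intro z hz
    by_contra hzy
    refine frontier_connectedComponentIn_subset hG x hz ⟨?_, hzy⟩
    exact (hLU (hML (hclM (closure_mono hsubO hz.1)))).2
  exact (Set.encard_le_encard hsub).trans ((Set.encard_insert_le _ _).trans (by rw [Set.encard_singleton]; rfl))

variable (X) in
/-- All but countably many local cut points have Menger order at most two. -/
theorem countable_isLocalCutPoint_not_hasSmallBoundaryBasis_two [RegularSpace X]
    [LocallyCompactSpace X] [SecondCountableTopology X] :
    {x : X | IsLocalCutPoint x ∧ ¬ HasSmallBoundaryBasis x 2}.Countable := by
  obtain ⟨𝒰, h𝒰c, h𝒰, h𝒰b⟩ := exists_countable_isOpen_isPreconnected X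
  obtain ⟨D, hDc, hD⟩ := exists_countable_dense X
  -- `T` collects points with three local sides, `S` those that fail to be a limit of separating
  -- points from some side. Both are countable unions of subsingletons.
  let T : Set X := ⋃ U ∈ 𝒰, ⋃ a ∈ D, ⋃ b ∈ D, ⋃ c ∈ D,
    {x | Separates U x a b ∧ Separates U x a c ∧ Separates U x b c}
  let S : Set X := ⋃ U ∈ 𝒰, ⋃ a ∈ D, ⋃ b ∈ D, ⋃ B ∈ countableBasis X,
    {x | x ∈ B ∧ Separates U x a b ∧
      ∀ y ∈ B, Separates U y a b → y ∉ connectedComponentIn (U \ {x}) a}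
  have hT : T.Countable := h𝒰c.biUnion fun U hU => hDc.biUnion fun a _ => hDc.biUnion fun b _ =>
    hDc.biUnion fun c _ => (subsingleton_separates_three (h𝒰 U hU).1 (h𝒰 U hU).2 a b c).countable
  have hS : S.Countable := h𝒰c.biUnion fun U hU => hDc.biUnion fun a _ => hDc.biUnion fun b _ =>
    (countable_countableBasis X).biUnion fun B _ =>
      (subsingleton_separates_first (h𝒰 U hU).1 (h𝒰 U hU).2 a b B).countable
  refine (hT.union hS).mono ?_
  rintro x ⟨hx, hx2⟩
  by_contra hxTS
  simp only [mem_union, not_or] at hxTS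
  obtain ⟨hxT, hxS⟩ := hxTS
  apply hx2
  obtain ⟨V, hV, hVW⟩ := hx.exists_open
  obtain ⟨U, hU𝒰, hxU, hUV⟩ := h𝒰b x V hV
  obtain ⟨hU, hU'⟩ := h𝒰 U hU𝒰
  obtain ⟨a, ha, b, hb, hab⟩ := exists_notMem_connectedComponentIn (hVW U hUV hU hxU)
  have pick : ∀ z ∈ U \ {x}, ∃ d ∈ D, d ∈ connectedComponentIn (U \ {x}) z := fun z hz => by
    obtain ⟨d, hd, hdD⟩ := hD.inter_open_nonempty _ (isOpen_component hU x z)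
      ⟨z, mem_connectedComponentIn hz⟩
    exact ⟨d, hdD, hd⟩
  obtain ⟨a', haD, ha'⟩ := pick a ha
  obtain ⟨b', hbD, hb'⟩ := pick b hb
  have hsep : Separates U x a' b' := by
    refine ⟨connectedComponentIn_subset _ _ ha', connectedComponentIn_subset _ _ hb', ?_⟩
    rw [← connectedComponentIn_eq ha']
    exact fun h => Set.disjoint_left.1 (disjoint_connectedComponentIn hab) h hb'
  have hlim : ∀ p ∈ D, ∀ q ∈ D, Separates U x p q → IsSideLimit U x p q := by
    intro p hp q hq hpq
    refine (isBasis_countableBasis X).mem_closure_iff.2 fun B hB hxB => ?_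
    by_contra hno
    refine hxS (mem_biUnion hU𝒰 (mem_biUnion hp (mem_biUnion hq (mem_biUnion hB
      ⟨hxB, hpq, fun y hyB hy hyx => hno ⟨y, hyB, hy, hyx⟩⟩))))
  refine hasSmallBoundaryBasis_two hU hU' hsep ?_ (hlim a' haD b' hbD hsep)
    (hlim b' hbD a' haD hsep.symm)
  intro z hz
  by_contra hzab
  simp only [mem_union, not_or] at hzab
  obtain ⟨c, hcD, hc⟩ := pick z hz
  have hc' : ∀ p, z ∉ connectedComponentIn (U \ {x}) p → c ∉ connectedComponentIn (U \ {x}) p :=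
    fun p hp h => Set.disjoint_left.1 (disjoint_connectedComponentIn hp) h hc
  have hcU := connectedComponentIn_subset _ _ hc
  exact hxT (mem_biUnion hU𝒰 (mem_biUnion haD (mem_biUnion hbD (mem_biUnion hcD
    ⟨hsep, ⟨hsep.1, hcU, hc' _ hzab.1⟩, ⟨hsep.2.1, hcU, hc' _ hzab.2⟩⟩))))

end LocalStructure

/-! ### Non-cut points: Gδ, existence, isolated ones -/

section NonCutPoints

variable {X : Type*} [TopologicalSpace X]

lemma isCutPoint_iff_exists_separates {x : X} :
    IsCutPoint x ↔ ∃ a b, Separates univ x a b := by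
  rw [IsCutPoint, compl_eq_univ_sdiff, isPreconnected_iff_not_separates]
  push Not
  rfl

variable [LocallyConnectedSpace X] [T1Space X]

-- Components are open, so separation of pairs from a countable dense set suffices. For a fixed
-- pair, the non-separating points are the pair itself plus an open set.
variable (X) in
lemma isGδ_setOf_not_isCutPoint [RegularSpace X] [SecondCountableTopology X] :
    IsGδ {x : X | ¬ IsCutPoint x} := by
  obtain ⟨D, hDc, hD⟩ := exists_countable_dense X
  have heq : {x : X | ¬ IsCutPoint x} = ⋂ a ∈ D, ⋂ b ∈ D, {x | ¬ Separates univ x a b} := by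
    ext x
    simp only [mem_ofPred_eq, mem_iInter]
    constructor
    · exact fun h a _ b _ hab => h (isCutPoint_iff_exists_separates.2 ⟨a, b, hab⟩)
    · intro h hx
      obtain ⟨a, b, hab⟩ := isCutPoint_iff_exists_separates.1 hx
      obtain ⟨a', ha', haD⟩ := hD.inter_open_nonempty _ (isOpen_component isOpen_univ x a)
        ⟨a, mem_connectedComponentIn hab.1⟩
      obtain ⟨b', hb', hbD⟩ := hD.inter_open_nonempty _ (isOpen_component isOpen_univ x b)
        ⟨b, mem_connectedComponentIn hab.2.1⟩
      refine h a' haD b' hbD ⟨connectedComponentIn_subset _ _ ha',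
        connectedComponentIn_subset _ _ hb', fun hc => ?_⟩
      rw [← connectedComponentIn_eq ha'] at hc
      exact Set.disjoint_left.1 (disjoint_connectedComponentIn hab.2.2) hc hb'
  rw [heq]
  refine IsGδ.biInter hDc fun a _ => IsGδ.biInter hDc fun b _ => ?_
  have hsplit : {x : X | ¬ Separates univ x a b} =
      {a, b} ∪ {x | x ≠ a ∧ x ≠ b ∧ ¬ Separates univ x a b} := by
    ext x
    simp only [mem_ofPred_eq, mem_union, mem_insert_iff, mem_singleton_iff]
    constructor
    · tauto
    · rintro ((rfl | rfl) | h)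
      · exact fun h => h.1.2 rfl
      · exact fun h => h.2.1.2 rfl
      · exact h.2.2
  rw [hsplit]
  refine (Set.toFinite _).isGδ.union (IsOpen.isGδ (isOpen_iff_mem_nhds.2 ?_))
  rintro x ⟨hxa, hxb, hx⟩
  have ha : a ∈ (univ : Set X) \ {x} := ⟨mem_univ _, hxa.symm⟩
  have hb : b ∈ connectedComponentIn (univ \ {x}) a := by
    by_contra h
    exact hx ⟨ha, ⟨mem_univ _, hxb.symm⟩, h⟩
  -- `K` joins `a` to `b` away from `x`, so no point near `x` separates them.
  obtain ⟨K, -, hKc, hK, hKx⟩ := exists_isOpen_isPreconnected_closure_subset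
    (isOpen_component isOpen_univ x a) isPreconnected_connectedComponentIn
    (Set.toFinite {a, b}).isCompact
    (by rintro z (rfl | rfl); exacts [mem_connectedComponentIn ha, hb])
  have hxK : x ∉ closure K := fun h => (connectedComponentIn_subset _ _ (hKx h)).2 rfl
  filter_upwards [isClosed_closure.isOpen_compl.mem_nhds hxK] with y hy
  have hyK : K ⊆ univ \ {y} := fun z hz => ⟨mem_univ _, by rintro rfl; exact hy (subset_closure hz)⟩
  have haK := hK (mem_insert a {b})
  have hbK := hK (mem_insert_of_mem a (mem_singleton b))
  refine ⟨(hyK haK).2.imp Eq.symm, (hyK hbK).2.imp Eq.symm, fun h => h.2.2 ?_⟩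
  exact hKc.subset_connectedComponentIn haK hyK hbK

variable [PreconnectedSpace X]

/-- The complement of a component of the complement of a point is connected; it lies in any
component it meets after removing another point. -/
lemma component_subset_component {q z w r v : X} (hr : r ∈ connectedComponentIn (univ \ {z}) w)
    (hq : q ∉ connectedComponentIn (univ \ {z}) w)
    (hv : q ∉ connectedComponentIn (univ \ {r}) v) :
    connectedComponentIn (univ \ {r}) v ⊆ connectedComponentIn (univ \ {z}) w := by
  have hrz : r ≠ z := (connectedComponentIn_subset _ _ hr).2
  have hz : ∀ s ∉ connectedComponentIn (univ \ {z}) w, s ∈ connectedComponentIn (univ \ {r}) z := by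
    intro s hs
    by_cases hsz : s = z
    · subst hsz
      exact mem_connectedComponentIn ⟨mem_univ _, hrz.symm⟩
    have hs' : s ∈ (univ : Set X) \ {z} := ⟨mem_univ _, hsz⟩
    have hrs : r ∉ connectedComponentIn (univ \ {z}) s :=
      Set.disjoint_left.1 (disjoint_connectedComponentIn hs) hr
    have h := insert_component_subset isOpen_univ isPreconnected_univ (mem_univ z) hrz hs' hrs
    rw [← connectedComponentIn_eq (h (mem_insert _ _))]
    exact h (mem_insert_of_mem _ (mem_connectedComponentIn hs'))
  intro s hs
  by_contra hs'
  apply hv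
  rw [connectedComponentIn_eq hs, ← connectedComponentIn_eq (hz s hs')]
  exact hz q hq

/-- Every component of the complement of a point contains a point which is not a cut point. -/
theorem exists_not_isCutPoint_mem_component [CompactSpace X] {q d : X} (hd : d ≠ q) :
    ∃ r ∈ connectedComponentIn (univ \ {q}) d, ¬ IsCutPoint r := by
  by_contra! hcut
  set D := connectedComponentIn (univ \ {q}) d
  have hqD : q ∉ D := fun h => (connectedComponentIn_subset _ _ h).2 rfl
  -- If all points of `D` are cut points, below any member containing `r` lies a member missing `r`,
  -- so `S` has no minimal element, against Zorn.
  let S : Set (Set X) :=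
    {A | A ⊆ D ∧ ∃ z w, w ≠ z ∧ A = connectedComponentIn (univ \ {z}) w}
  have step : ∀ r ∈ D, ∃ v, v ≠ r ∧ q ∉ connectedComponentIn (univ \ {r}) v := by
    intro r hr
    obtain ⟨a, b, hab⟩ := isCutPoint_iff_exists_separates.1 (hcut r hr)
    by_cases hqa : q ∈ connectedComponentIn (univ \ {r}) a
    · exact ⟨b, hab.2.1.2, Set.disjoint_left.1 (disjoint_connectedComponentIn hab.2.2) hqa⟩
    · exact ⟨a, hab.1.2, hqa⟩
  have below : ∀ r ∈ D, ∃ B ∈ S, r ∉ B ∧ ∀ A ∈ S, r ∈ A → B ⊆ A := by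
    intro r hr
    obtain ⟨v, hvr, hv⟩ := step r hr
    refine ⟨connectedComponentIn (univ \ {r}) v,
      ⟨component_subset_component hr hqD hv, r, v, hvr, rfl⟩,
      fun h => (connectedComponentIn_subset _ _ h).2 rfl, ?_⟩
    rintro _ ⟨hAD, z, w, hwz, rfl⟩ hrA
    exact component_subset_component hrA (fun h => hqD (hAD h)) hv
  have hne : ∀ A ∈ S, A.Nonempty := by
    rintro _ ⟨-, z, w, hwz, rfl⟩
    exact ⟨w, mem_connectedComponentIn ⟨mem_univ _, hwz⟩⟩
  have hclosure : ∀ A ∈ S, ∀ B ∈ S, ¬ A ⊆ B → B ⊆ A → closure B ⊆ A := by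
    rintro _ ⟨-, z, w, hwz, rfl⟩ _ ⟨-, z', w', hwz', rfl⟩ hAB hBA
    have hz' : z' ∈ connectedComponentIn (univ \ {z}) w := by
      by_contra hz'
      apply hAB
      have hw' := mem_connectedComponentIn (x := w') (F := univ \ {z'}) ⟨mem_univ _, hwz'⟩
      refine isPreconnected_connectedComponentIn.subset_connectedComponentIn (hBA hw')
        fun s hs => ⟨mem_univ _, ?_⟩
      rintro rfl
      exact hz' hs
    intro s hs
    by_cases hsz : s = z'
    · rwa [hsz]
    · exact hBA (closure_connectedComponentIn_inter_subset
        (isOpen_univ.sdiff isClosed_singleton) w' ⟨hs, mem_univ _, hsz⟩)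
  obtain ⟨M, -, hM⟩ := zorn_superset_nonempty S (by
    intro c hcS hc hcne
    by_cases hmin : ∃ A ∈ c, ∀ B ∈ c, A ⊆ B
    · obtain ⟨A, hA, hAB⟩ := hmin
      exact ⟨A, hcS hA, hAB⟩
    push Not at hmin
    -- In a chain with no least member closures nest, so compactness gives a common point `r`, and
    -- `below r` yields a lower bound.
    have hlt : ∀ A ∈ c, ∃ B ∈ c, closure B ⊆ A := by
      intro A hA
      obtain ⟨B, hB, hAB⟩ := hmin A hA
      exact ⟨B, hB, hclosure A (hcS hA) B (hcS hB) hAB ((hc.total hA hB).resolve_left hAB)⟩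
    obtain ⟨A₀, hA₀⟩ := hcne
    have hinter : (⋂₀ (closure '' c)).Nonempty := by
      have : Nonempty (closure '' c) := ⟨⟨_, A₀, hA₀, rfl⟩⟩
      refine IsCompact.nonempty_sInter_of_directed_nonempty_isCompact_isClosed ?_ ?_ ?_ ?_
      · rintro _ ⟨A, hA, rfl⟩ _ ⟨B, hB, rfl⟩
        rcases hc.total hA hB with h | h
        · exact ⟨_, ⟨A, hA, rfl⟩, subset_rfl, closure_mono h⟩
        · exact ⟨_, ⟨B, hB, rfl⟩, closure_mono h, subset_rfl⟩
      · rintro _ ⟨A, hA, rfl⟩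
        exact (hne A (hcS hA)).closure
      · rintro _ ⟨A, hA, rfl⟩
        exact isClosed_closure.isCompact
      · rintro _ ⟨A, hA, rfl⟩
        exact isClosed_closure
    obtain ⟨r, hr⟩ := hinter
    have hrA : ∀ A ∈ c, r ∈ A := fun A hA => by
      obtain ⟨B, hB, hBA⟩ := hlt A hA
      exact hBA (hr _ ⟨B, hB, rfl⟩)
    obtain ⟨B, hB, -, hBA⟩ := below r ((hcS hA₀).1 (hrA A₀ hA₀))
    exact ⟨B, hB, fun A hA => hBA A (hcS hA) (hrA A hA)⟩) D ⟨subset_rfl, q, d, hd, rfl⟩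
  obtain ⟨r, hr⟩ := hne M hM.prop
  obtain ⟨B, hB, hrB, hBM⟩ := below r (hM.prop.1 hr)
  exact hrB (hM.le_of_le hB (hBM M hM.prop hr) hr)

variable (X) in
lemma exists_not_isCutPoint [CompactSpace X] [Nontrivial X] : ∃ x : X, ¬ IsCutPoint x := by
  obtain ⟨q, d, hqd⟩ := exists_pair_ne X
  obtain ⟨r, -, hr⟩ := exists_not_isCutPoint_mem_component hqd.symm
  exact ⟨r, hr⟩

/-- An isolated point of the set of non-cut points is an end point. -/
theorem hasSmallBoundaryBasis_one_of_isolated [CompactSpace X] [RegularSpace X] [Nontrivial X]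
    {p : X} (hp : ¬ IsCutPoint p) {W : Set X} (hW : W ∈ 𝓝 p)
    (hWp : ∀ x ∈ W, x ≠ p → IsCutPoint x) : HasSmallBoundaryBasis p 1 := by
  refine hasSmallBoundaryBasis_of_forall fun O' hO' hpO' => ?_
  set O := O' ∩ interior W
  have hO : IsOpen O := hO'.inter isOpen_interior
  have hpO : p ∈ O := ⟨hpO', mem_interior_iff_mem_nhds.2 hW⟩
  obtain ⟨K, -, hKc, hOK, hKp⟩ := exists_isOpen_isPreconnected_closure_subset (C := {p}ᶜ)
    isOpen_compl_singleton (not_not.1 hp) hO.isClosed_compl.isCompact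
    (fun z hz h => hz (by rw [mem_singleton_iff.1 h]; exact hpO))
  have hpK : p ∉ closure K := fun h => hKp h rfl
  have hnhds : O ∩ (closure K)ᶜ ∈ 𝓝 p :=
    (hO.inter isClosed_closure.isOpen_compl).mem_nhds ⟨hpO, hpK⟩
  have : ConnectedSpace X := ⟨⟨p⟩⟩
  obtain ⟨q, ⟨hqO, hqK⟩, hqp⟩ : ((O ∩ (closure K)ᶜ) ∩ {p}ᶜ).Nonempty :=
    Filter.nonempty_of_mem (inter_mem (mem_nhdsWithin_of_mem_nhds hnhds) self_mem_nhdsWithin)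
  have hpq : p ∈ (univ : Set X) \ {q} := ⟨mem_univ _, fun h => hqp h.symm⟩
  have hKq : K ⊆ univ \ {q} := fun z hz => ⟨mem_univ _, by rintro rfl; exact hqK (subset_closure hz)⟩
  -- Such a component has a non-cut point, which cannot lie in `O`, hence lies in `K` and drags all
  -- of `K` along. As `q` is a cut point, one such component exists, so the component of `p` avoids
  -- `K` and lies in `O`.
  have hother : ∀ d ∈ (univ : Set X) \ {q}, p ∉ connectedComponentIn (univ \ {q}) d →
      K ⊆ connectedComponentIn (univ \ {q}) d := by
    intro d hd hpd
    obtain ⟨r, hrd, hr⟩ := exists_not_isCutPoint_mem_component hd.2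
    have hrK : r ∈ K := by
      apply hOK
      intro hrO
      refine hr (hWp r (interior_subset hrO.2) ?_)
      rintro rfl
      exact hpd hrd
    rw [connectedComponentIn_eq hrd]
    exact hKc.subset_connectedComponentIn hrK hKq
  obtain ⟨d, hd, hpd⟩ : ∃ d ∈ (univ : Set X) \ {q}, p ∉ connectedComponentIn (univ \ {q}) d := by
    obtain ⟨a, b, hab⟩ :=
      isCutPoint_iff_exists_separates.1 (hWp q (interior_subset hqO.2) hqp)
    by_cases hpa : p ∈ connectedComponentIn (univ \ {q}) a
    · exact ⟨b, hab.2.1, Set.disjoint_left.1 (disjoint_connectedComponentIn hab.2.2) hpa⟩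
    · exact ⟨a, hab.1, hpa⟩
  refine ⟨connectedComponentIn (univ \ {q}) p, (isOpen_component isOpen_univ q p).mem_nhds
    (mem_connectedComponentIn hpq), ?_, ?_⟩
  · intro z hz
    by_contra hzO
    exact Set.disjoint_left.1 (disjoint_connectedComponentIn hpd)
      (hother d hd hpd (hOK fun h => hzO h.1)) hz
  · have hsub : frontier (connectedComponentIn (univ \ {q}) p) ⊆ {q} := by
      intro z hz
      by_contra hzq
      exact frontier_connectedComponentIn_subset (isOpen_univ.sdiff isClosed_singleton) p hz
        ⟨mem_univ _, hzq⟩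
    refine (Set.encard_le_encard hsub).trans ?_
    rw [Set.encard_singleton]
    rfl

end NonCutPoints

end PeanoContinuum

/-! ### The Baire category argument -/

open PeanoContinuum

theorem mainTheorem3 (X : Type*) [TopologicalSpace X] [TopologicalSpace.MetrizableSpace X]
    [CompactSpace X] [ConnectedSpace X] [LocallyConnectedSpace X] [Nontrivial X] :
    ∃ x : X, ¬ PeanoContinuum.IsLocalCutPoint x ∨
      (PeanoContinuum.IsLocalCutPoint x ∧ ¬ PeanoContinuum.IsCutPoint x ∧
        PeanoContinuum.mengerOrder x = 2) := by
  by_contra! H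
  have hlocal : ∀ x : X, IsLocalCutPoint x := fun x => (H x).1
  have : SecondCountableTopology X := by
    let _ := metrizableSpaceMetric X
    exact EMetric.secondCountable_of_sigmaCompact X
  set N : Set X := {x | ¬ IsCutPoint x}
  have : BaireSpace N := (isGδ_setOf_not_isCutPoint X).baireSpace_of_t2Space_locallyCompactSpace
  have : Nonempty N := nonempty_subtype.2 (exists_not_isCutPoint X)
  have hsub : N ⊆ {x : X | IsLocalCutPoint x ∧ ¬ HasSmallBoundaryBasis x 2} := fun x hx =>
    ⟨hlocal x, fun h2 => (H x).2 (hlocal x) hx ((hlocal x).mengerOrder_eq_two h2)⟩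
  have hcount : N.Countable :=
    (countable_isLocalCutPoint_not_hasSmallBoundaryBasis_two X).mono hsub
  have : Countable N := hcount.to_subtype
  have hU : (⋃ x : N, ({x} : Set N)) = univ := iUnion_of_singleton N
  -- By Baire, some singleton of the countable space `N` has interior: an isolated point.
  obtain ⟨p, y, hy⟩ := nonempty_interior_of_iUnion_of_closed (fun _ => isClosed_singleton) hU
  have hyp : y = p := mem_singleton_iff.1 (interior_subset hy)
  subst hyp
  obtain ⟨W, hW, hWy⟩ := (mem_nhds_subtype N y {y}).1 (mem_interior_iff_mem_nhds.1 hy)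
  have hW' : ∀ x ∈ W, x ≠ (y : X) → IsCutPoint x := by
    intro x hxW hxy
    by_contra hx
    have hmem : (⟨x, hx⟩ : N) ∈ ({y} : Set N) := hWy hxW
    exact hxy (congrArg Subtype.val (mem_singleton_iff.1 hmem))
  exact absurd ((hlocal y).two_le (hasSmallBoundaryBasis_one_of_isolated y.2 hW hW')) (by norm_num)
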